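/- Let $\rho,\sigma$ be states (positive semidefinite operators of trace $1$) on a Hilbert space $\mathcal H_S$ of finite dimension $n$ whose joint support is all of it, i.e. $\operatorname{supp}\rho+\operatorname{supp}\sigma=\mathcal H_S$. For a Hilbert space $\mathcal H$ of finite dimension, with a fixed orthonormal basis, let $\mathcal J(\mathcal H)$ be the set of operators $J$ on $\mathcal H_A\otimes\mathcal H_B$, where $\mathcal H_A=\mathcal H_B=\mathcal H$, with $J^{T_A}\ge 0$ (partial transpose on the first factor) and $\operatorname{Tr}_B J=\mathbb 1$. These are the Jamiołkowski matrices of the quantum channels $\mathcal E$ on $\mathcal B(\mathcal H)$, with $\mathcal E(x)=\operatorname{Tr}_A[(x\otimes\mathbb 1)J]$. For a Hermitian operator $K$ on $\mathcal H\otimes\mathcal H$ and states $\rho',\sigma'$ on $\mathcal H$, the quantum transport cost with cost matrix $K$ is $$\min\Big\{\operatorname{Tr}[KQ]\;:\;Q=\tfrac12\big((\rho'\otimes\mathbb 1)J+J(\rho'\otimes\mathbb 1)\big),\ J\in\mathcal J(\mathcal H),\ \operatorname{Tr}_A[(\rho'\otimes\mathbb 1)J]=\sigma'\Big\}.$$ For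 each $d\ge n$ let $\mathcal H_d=\mathcal H_S\oplus\mathcal H_\bot$ be a Hilbert space of dimension $d$ in which $\mathcal H_S$ is isometrically embedded, regard $\rho,\sigma$ as states on $\mathcal H_d$ that vanish on $\mathcal H_\bot$, and let $\mathcal K_d(\rho,\sigma)$ be their quantum transport cost with cost matrix $\mathbb 1_d-\frac1d\mathbb S_d$, where $\mathbb S_d$ is the swap operator on $\mathcal H_d\otimes\mathcal H_d$. Then the minimum defining $\mathcal K_d(\rho,\sigma)$ is attained for every $d\ge n$, and for every choice of the embeddings $$\lim_{d\to\infty}\mathcal K_d(\rho,\sigma)=1-\max_{\{E_k\}}\sqrt{\sum_k\big|\operatorname{Tr}[\rho E_k]\big|^2},$$ where the maximum is attained and runs over all finite families $\{E_k\}$ of operators on $\mathcal H_S$ with $\sum_k E_k^*E_k=\mathbb 1$ and $\sum_k E_k\rho E_k^*=\sigma$. -/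

import Mathlib

open scoped ComplexOrder Kronecker Matrix

noncomputable section

namespace QuantumTransport

/-! Finite dimensional Hilbert spaces are given by orthonormal bases: operators on `H_A` are
matrices `Matrix A A ℂ` with `A` a finite index type, and operators on `H_A ⊗ H_B` are matrices
indexed by `A × B`. -/

/-- A state (density operator): positive semidefinite with trace one. -/
def IsState {A : Type*} [Fintype A] (ρ : Matrix A A ℂ) : Prop :=
  ρ.PosSemidef ∧ ρ.trace = 1

/-- The joint support `supp ρ + supp σ`; the support of a Hermitian operator is its range. -/
def jointSupport {A : Type*} [Fintype A] (ρ σ : Matrix A A ℂ) : Submodule ℂ (A → ℂ) :=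
  LinearMap.range ρ.mulVecLin ⊔ LinearMap.range σ.mulVecLin

/-- The partial trace `Tr_A`. -/
def partialTraceA {A B : Type*} [Fintype A] (M : Matrix (A × B) (A × B) ℂ) : Matrix B B ℂ :=
  Matrix.of fun b b' => ∑ a, M (a, b) (a, b')

/-- The partial trace `Tr_B`. -/
def partialTraceB {A B : Type*} [Fintype B] (M : Matrix (A × B) (A × B) ℂ) : Matrix A A ℂ :=
  Matrix.of fun a a' => ∑ b, M (a, b) (a', b)

/-- The partial transpose `M ^ T_A`. -/
def partialTransposeA {A B : Type*} (M : Matrix (A × B) (A × B) ℂ) :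
    Matrix (A × B) (A × B) ℂ :=
  Matrix.of fun p q => M (q.1, p.2) (p.1, q.2)

/-- Jamiołkowski matrices of quantum channels `B(H_A) → B(H_B)`:
`J ^ T_A ≥ 0` and `Tr_B J = 1`. -/
def IsJamiolkowski {A B : Type*} [Fintype B] [DecidableEq A]
    (J : Matrix (A × B) (A × B) ℂ) : Prop :=
  (partialTransposeA J).PosSemidef ∧ partialTraceB J = 1

/-- The Jordan product `X ⋆ Y = (X Y + Y X) / 2`. -/
def jordanProduct {A : Type*} [Fintype A] (X Y : Matrix A A ℂ) : Matrix A A ℂ :=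
  (1 / 2 : ℂ) • (X * Y + Y * X)

/-- The states over time between `ρ` and `σ`: all `(ρ ⊗ 1) ⋆ J`, with `J` the Jamiołkowski matrix
of a channel that maps `ρ` to `σ`, that is `Tr_A[(ρ ⊗ 1) J] = σ`. -/
def statesOverTime {A B : Type*} [Fintype A] [Fintype B] [DecidableEq A] [DecidableEq B]
    (ρ : Matrix A A ℂ) (σ : Matrix B B ℂ) : Set (Matrix (A × B) (A × B) ℂ) :=
  {Q | ∃ J : Matrix (A × B) (A × B) ℂ, IsJamiolkowski J ∧
    partialTraceA ((ρ ⊗ₖ (1 : Matrix B B ℂ)) * J) = σ ∧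
    Q = jordanProduct (ρ ⊗ₖ (1 : Matrix B B ℂ)) J}

/-- The costs `Tr[K Q]` of the states over time `Q` between `ρ` and `σ`. For Hermitian `K` these
traces are real numbers. -/
def costValues {A B : Type*} [Fintype A] [Fintype B] [DecidableEq A] [DecidableEq B]
    (K : Matrix (A × B) (A × B) ℂ) (ρ : Matrix A A ℂ) (σ : Matrix B B ℂ) : Set ℝ :=
  (fun Q => (K * Q).trace.re) '' statesOverTime ρ σ

/-- The quantum transport cost `min_Q Tr[K Q]`. -/
def transportCost {A B : Type*} [Fintype A] [Fintype B] [DecidableEq A] [DecidableEq B]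
    (K : Matrix (A × B) (A × B) ℂ) (ρ : Matrix A A ℂ) (σ : Matrix B B ℂ) : ℝ :=
  sInf (costValues K ρ σ)

/-- The swap operator `S = ∑ i j, |i j⟩⟨j i|`. -/
def swapOperator (A : Type*) [DecidableEq A] : Matrix (A × A) (A × A) ℂ :=
  Matrix.of fun p q => if p.1 = q.2 ∧ p.2 = q.1 then 1 else 0

/-- The cost matrix `1 - S / d` in dimension `d`. -/
def costMatrix (d : ℕ) : Matrix (Fin d × Fin d) (Fin d × Fin d) ℂ :=
  1 - (1 / (d : ℂ)) • swapOperator (Fin d)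

/-- The operator `V X V*`: for an isometry `V`, the operator `X` on `H_S` regarded as an operator
on `H_d = V(H_S) ⊕ V(H_S)ᗮ`, equal to zero on the second summand. -/
def embed {S D : Type*} [Fintype S] (V : Matrix D S ℂ) (X : Matrix S S ℂ) : Matrix D D ℂ :=
  V * X * Vᴴ

/-- Kraus operators of a channel (a trace preserving map `X ↦ ∑ k, E k X (E k)*`) that maps
`ρ` to `σ`. -/
def IsAdmissibleKraus {S κ : Type*} [Fintype S] [DecidableEq S] [Fintype κ]
    (ρ σ : Matrix S S ℂ) (E : κ → Matrix S S ℂ) : Prop :=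
  ∑ k, (E k)ᴴ * E k = 1 ∧ ∑ k, E k * ρ * (E k)ᴴ = σ

/-- The values of `sqrt (∑ k, |Tr[ρ E_k]|²)` over all finite families of admissible Kraus
operators. -/
def krausValues {S : Type*} [Fintype S] [DecidableEq S] (ρ σ : Matrix S S ℂ) : Set ℝ :=
  {x | ∃ (r : ℕ) (E : Fin r → Matrix S S ℂ), IsAdmissibleKraus ρ σ E ∧
    x = √(∑ k, ‖(ρ * E k).trace‖ ^ 2)}

end QuantumTransport

end

open QuantumTransport

noncomputable section

namespace QuantumTransport

/-- The Jamiołkowski matrix of the completely positive map with Kraus operators `E`. -/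
def krausJamiolkowski {A κ : Type*} [Fintype κ] (E : κ → Matrix A A ℂ) :
    Matrix (A × A) (A × A) ℂ :=
  Matrix.of fun p q => ∑ k, E k p.2 q.1 * star (E k q.2 p.1)

section Jamiolkowski

variable {A κ : Type*} [Fintype κ]

lemma posSemidef_partialTransposeA_krausJamiolkowski [Finite A] (E : κ → Matrix A A ℂ) :
    (partialTransposeA (krausJamiolkowski E)).PosSemidef := by
  have h : partialTransposeA (krausJamiolkowski E) =
      (Matrix.of fun (p : A × A) (k : κ) => E k p.2 p.1) *
        (Matrix.of fun (p : A × A) (k : κ) => E k p.2 p.1)ᴴ := by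
    ext p q
    simp [partialTransposeA, krausJamiolkowski, Matrix.mul_apply]
  rw [h]
  exact Matrix.posSemidef_self_mul_conjTranspose _

variable [Fintype A]

lemma exists_conjTranspose_mul_self_eq [DecidableEq A] {P : Matrix A A ℂ} (hP : P.PosSemidef) :
    ∃ B : Matrix A A ℂ, Bᴴ * B = P := by
  open scoped MatrixOrder Matrix.Norms.L2Operator in
  obtain ⟨B, rfl⟩ := CStarAlgebra.nonneg_iff_eq_star_mul_self.mp hP.nonneg
  exact ⟨B, rfl⟩

lemma exists_krausJamiolkowski_eq [DecidableEq A] {J : Matrix (A × A) (A × A) ℂ}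
    (hJ : (partialTransposeA J).PosSemidef) :
    ∃ E : A × A → Matrix A A ℂ, krausJamiolkowski E = J := by
  obtain ⟨B, hB⟩ := exists_conjTranspose_mul_self_eq hJ
  refine ⟨fun k => Matrix.of fun b a => star (B k (a, b)), ?_⟩
  ext p q
  have h : (Bᴴ * B) (q.1, p.2) (p.1, q.2) = J p q := by rw [hB]; rfl
  rw [← h]
  simp [krausJamiolkowski, Matrix.mul_apply]

lemma partialTraceB_krausJamiolkowski (E : κ → Matrix A A ℂ) :
    partialTraceB (krausJamiolkowski E) = ∑ k, (E k)ᴴ * E k := by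
  ext a a'
  simp only [partialTraceB, krausJamiolkowski, Matrix.of_apply, Matrix.sum_apply, Matrix.mul_apply,
    Matrix.conjTranspose_apply]
  rw [Finset.sum_comm]
  simp only [mul_comm]

lemma sum_sum_sum_rotate {α β γ : Type*} [Fintype α] [Fintype β] [Fintype γ]
    (f : α → β → γ → ℂ) : ∑ a, ∑ b, ∑ c, f a b c = ∑ c, ∑ a, ∑ b, f a b c := by
  rw [Finset.sum_comm (s := (Finset.univ : Finset γ))]
  exact Finset.sum_congr rfl fun a _ => Finset.sum_comm

lemma sum_norm_sq_trace_mul (ρ : Matrix A A ℂ) (E : κ → Matrix A A ℂ) :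
    ((∑ k, ‖(ρ * E k).trace‖ ^ 2 : ℝ) : ℂ) =
      ∑ p : A × A, ∑ q : A × A, ρ p.1 p.2 * star (ρ q.1 q.2) *
        krausJamiolkowski E (q.1, p.2) (p.1, q.2) := by
  push_cast
  simp only [krausJamiolkowski, Matrix.of_apply, Finset.mul_sum]
  rw [sum_sum_sum_rotate]
  refine Finset.sum_congr rfl fun k _ => ?_
  rw [← Complex.mul_conj']
  have h : (ρ * E k).trace = ∑ p : A × A, ρ p.1 p.2 * E k p.2 p.1 := by
    simp [Matrix.trace, Matrix.mul_apply, Fintype.sum_prod_type]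
  rw [h, map_sum, Finset.sum_mul_sum]
  refine Finset.sum_congr rfl fun p _ => Finset.sum_congr rfl fun q _ => ?_
  simp
  ring

variable [DecidableEq A]

lemma kronecker_one_mul_apply (ρ : Matrix A A ℂ) (M : Matrix (A × A) (A × A) ℂ) (p q : A × A) :
    ((ρ ⊗ₖ (1 : Matrix A A ℂ)) * M) p q = ∑ c, ρ p.1 c * M (c, p.2) q := by
  simp [Matrix.mul_apply, Fintype.sum_prod_type, Matrix.one_apply]

lemma mul_kronecker_one_apply (ρ : Matrix A A ℂ) (M : Matrix (A × A) (A × A) ℂ) (p q : A × A) :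
    (M * (ρ ⊗ₖ (1 : Matrix A A ℂ))) p q = ∑ c, M p (c, q.2) * ρ c q.1 := by
  simp [Matrix.mul_apply, Fintype.sum_prod_type, Matrix.one_apply]

lemma partialTraceA_mul_krausJamiolkowski (ρ : Matrix A A ℂ) (E : κ → Matrix A A ℂ) :
    partialTraceA ((ρ ⊗ₖ (1 : Matrix A A ℂ)) * krausJamiolkowski E) =
      ∑ k, E k * ρ * (E k)ᴴ := by
  ext b b'
  simp only [partialTraceA, kronecker_one_mul_apply, krausJamiolkowski, Matrix.of_apply,
    Matrix.sum_apply, Finset.mul_sum]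
  rw [sum_sum_sum_rotate]
  refine Finset.sum_congr rfl fun k _ => ?_
  simp only [Matrix.mul_apply, Matrix.conjTranspose_apply, Finset.sum_mul]
  rw [Finset.sum_comm]
  refine Finset.sum_congr rfl fun x _ => Finset.sum_congr rfl fun y _ => ?_
  ring

lemma trace_swapOperator_mul (M : Matrix (A × A) (A × A) ℂ) :
    (swapOperator A * M).trace = ∑ a, ∑ b, M (b, a) (a, b) := by
  simp only [Matrix.trace, Matrix.diag, Matrix.mul_apply, swapOperator, Matrix.of_apply,
    Fintype.sum_prod_type, ite_mul, one_mul, zero_mul, ite_and]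
  simp

lemma trace_swapOperator_mul_kronecker_mul {ρ : Matrix A A ℂ} (hρ : ρ.IsHermitian)
    (E : κ → Matrix A A ℂ) :
    (swapOperator A * ((ρ ⊗ₖ (1 : Matrix A A ℂ)) * krausJamiolkowski E)).trace =
      ∑ k, (E k).trace * star (ρ * E k).trace := by
  have hh : ∀ i j, star (ρ i j) = ρ j i := fun i j => hρ.apply j i
  simp only [trace_swapOperator_mul, kronecker_one_mul_apply, krausJamiolkowski, Matrix.of_apply,
    Finset.mul_sum]
  rw [Finset.sum_congr rfl fun a _ => sum_sum_sum_rotate _, Finset.sum_comm]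
  refine Finset.sum_congr rfl fun k _ => ?_
  simp only [Matrix.trace, Matrix.diag, Finset.sum_mul]
  refine Finset.sum_congr rfl fun x _ => ?_
  simp only [Matrix.mul_apply, Finset.mul_sum, star_sum, star_mul', hh]
  rw [Finset.sum_comm]
  refine Finset.sum_congr rfl fun y _ => Finset.sum_congr rfl fun z _ => ?_
  ring

lemma trace_swapOperator_mul_mul_kronecker (ρ : Matrix A A ℂ) (E : κ → Matrix A A ℂ) :
    (swapOperator A * (krausJamiolkowski E * (ρ ⊗ₖ (1 : Matrix A A ℂ)))).trace =
      ∑ k, star (E k).trace * (ρ * E k).trace := by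
  simp only [trace_swapOperator_mul, mul_kronecker_one_apply, krausJamiolkowski, Matrix.of_apply,
    Finset.sum_mul]
  rw [Finset.sum_congr rfl fun a _ => sum_sum_sum_rotate _, Finset.sum_comm]
  refine Finset.sum_congr rfl fun k _ => ?_
  simp only [Matrix.trace, Matrix.diag, star_sum, Finset.sum_mul]
  rw [Finset.sum_comm]
  refine Finset.sum_congr rfl fun x _ => ?_
  simp only [Matrix.mul_apply, Finset.mul_sum]
  rw [Finset.sum_comm]
  refine Finset.sum_congr rfl fun y _ => Finset.sum_congr rfl fun z _ => ?_
  ring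

lemma trace_kronecker_mul_krausJamiolkowski (ρ : Matrix A A ℂ) (E : κ → Matrix A A ℂ) :
    ((ρ ⊗ₖ (1 : Matrix A A ℂ)) * krausJamiolkowski E).trace =
      (∑ k, E k * ρ * (E k)ᴴ).trace := by
  rw [← partialTraceA_mul_krausJamiolkowski]
  simp only [Matrix.trace, Matrix.diag, partialTraceA, Matrix.of_apply, Fintype.sum_prod_type]
  exact Finset.sum_comm

end Jamiolkowski

section Cost

variable {κ : Type*} [Fintype κ]

lemma isJamiolkowski_krausJamiolkowski {A : Type*} [Fintype A] [DecidableEq A]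
    {ρ σ : Matrix A A ℂ} {E : κ → Matrix A A ℂ} :
    (IsJamiolkowski (krausJamiolkowski E) ∧
      partialTraceA ((ρ ⊗ₖ (1 : Matrix A A ℂ)) * krausJamiolkowski E) = σ) ↔
      IsAdmissibleKraus ρ σ E := by
  rw [IsJamiolkowski, partialTraceB_krausJamiolkowski, partialTraceA_mul_krausJamiolkowski,
    IsAdmissibleKraus]
  simp [posSemidef_partialTransposeA_krausJamiolkowski E]

variable {d : ℕ} {ρ σ : Matrix (Fin d) (Fin d) ℂ}

lemma re_trace_costMatrix_mul_jordanProduct (hρ : ρ.IsHermitian) (hσ : σ.trace = 1)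
    {E : κ → Matrix (Fin d) (Fin d) ℂ} (hE : IsAdmissibleKraus ρ σ E) :
    (costMatrix d * jordanProduct (ρ ⊗ₖ (1 : Matrix (Fin d) (Fin d) ℂ))
      (krausJamiolkowski E)).trace.re =
      1 - 1 / d * (∑ k, (E k).trace * star (ρ * E k).trace).re := by
  have h1 := trace_kronecker_mul_krausJamiolkowski ρ E
  rw [hE.2, hσ] at h1
  have h2 := Matrix.trace_mul_comm (ρ ⊗ₖ (1 : Matrix (Fin d) (Fin d) ℂ)) (krausJamiolkowski E)
  rw [h1] at h2
  have h3 : ∑ k, star (E k).trace * (ρ * E k).trace =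
      star (∑ k, (E k).trace * star (ρ * E k).trace) := by simp
  rw [costMatrix, jordanProduct, sub_mul, one_mul, Matrix.trace_sub, Matrix.mul_smul,
    Matrix.trace_smul, Matrix.trace_smul, Matrix.smul_mul, Matrix.trace_smul, mul_add,
    Matrix.trace_add, Matrix.trace_add, h1, ← h2, trace_swapOperator_mul_kronecker_mul hρ,
    trace_swapOperator_mul_mul_kronecker, h3]
  generalize ∑ k, (E k).trace * star (ρ * E k).trace = z
  have h4 : (1 / (d : ℂ)) = ((1 / d : ℝ) : ℂ) := by push_cast; rfl
  have h5 : (1 / 2 : ℂ) = ((1 / 2 : ℝ) : ℂ) := by push_cast; rfl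
  rw [h4, h5]
  simp only [smul_eq_mul, Complex.sub_re, Complex.re_ofReal_mul, Complex.add_re, Complex.star_def,
    Complex.conj_re, Complex.one_re]
  ring

lemma mem_costValues_of_isAdmissibleKraus (hρ : ρ.IsHermitian) (hσ : σ.trace = 1)
    {E : κ → Matrix (Fin d) (Fin d) ℂ} (hE : IsAdmissibleKraus ρ σ E) :
    1 - 1 / d * (∑ k, (E k).trace * star (ρ * E k).trace).re ∈
      costValues (costMatrix d) ρ σ := by
  have h := isJamiolkowski_krausJamiolkowski.2 hE
  exact ⟨_, ⟨_, h.1, h.2, rfl⟩, re_trace_costMatrix_mul_jordanProduct hρ hσ hE⟩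

lemma costValues_eq_image (hρ : ρ.IsHermitian) (hσ : σ.trace = 1) :
    costValues (costMatrix d) ρ σ =
      (fun E : Fin d × Fin d → Matrix (Fin d) (Fin d) ℂ =>
        1 - 1 / d * (∑ k, (E k).trace * star (ρ * E k).trace).re) ''
        {E | IsAdmissibleKraus ρ σ E} := by
  apply subset_antisymm
  · rintro _ ⟨_, ⟨J, hJ, hJσ, rfl⟩, rfl⟩
    obtain ⟨E, rfl⟩ := exists_krausJamiolkowski_eq hJ.1
    have hE := isJamiolkowski_krausJamiolkowski.1 ⟨hJ, hJσ⟩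
    exact ⟨E, hE, (re_trace_costMatrix_mul_jordanProduct hρ hσ hE).symm⟩
  · rintro _ ⟨E, hE, rfl⟩
    exact mem_costValues_of_isAdmissibleKraus hρ hσ hE

end Cost

section Admissible

variable {A κ : Type*} [Fintype A] [Fintype κ] {ρ σ : Matrix A A ℂ}

lemma trace_conjTranspose_mul_self_eq_sum (M : Matrix A A ℂ) :
    (Mᴴ * M).trace = ((∑ a, ∑ b, ‖M b a‖ ^ 2 : ℝ) : ℂ) := by
  simp [Matrix.trace, Matrix.mul_apply, Complex.conj_mul']

lemma norm_trace_sq_le (M : Matrix A A ℂ) :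
    ‖M.trace‖ ^ 2 ≤ Fintype.card A * ∑ a, ∑ b, ‖M b a‖ ^ 2 := by
  calc ‖M.trace‖ ^ 2 ≤ (∑ a, ‖M a a‖) ^ 2 := by
        gcongr
        exact norm_sum_le _ _
    _ ≤ Fintype.card A * ∑ a, ‖M a a‖ ^ 2 := sq_sum_le_card_mul_sum_sq
    _ ≤ Fintype.card A * ∑ a, ∑ b, ‖M b a‖ ^ 2 := by
        gcongr with a
        exact Finset.single_le_sum (f := fun b => ‖M b a‖ ^ 2) (fun _ _ => by positivity)
          (Finset.mem_univ a)

variable [DecidableEq A]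

lemma mem_krausValues_of_isAdmissibleKraus {E : κ → Matrix A A ℂ}
    (hE : IsAdmissibleKraus ρ σ E) :
    √(∑ k, ‖(ρ * E k).trace‖ ^ 2) ∈ krausValues ρ σ := by
  let e := (Fintype.equivFin κ).symm
  refine ⟨Fintype.card κ, E ∘ e, ⟨?_, ?_⟩, ?_⟩
  · rw [← hE.1]
    exact e.sum_comp fun k => (E k)ᴴ * E k
  · rw [← hE.2]
    exact e.sum_comp fun k => E k * ρ * (E k)ᴴ
  · congr 1
    exact (e.sum_comp fun k => ‖(ρ * E k).trace‖ ^ 2).symm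

lemma krausValues_eq_image :
    krausValues ρ σ = (fun E : A × A → Matrix A A ℂ => √(∑ k, ‖(ρ * E k).trace‖ ^ 2)) ''
      {E | IsAdmissibleKraus ρ σ E} := by
  apply subset_antisymm
  · rintro _ ⟨r, E, hE, rfl⟩
    obtain ⟨E', hE'⟩ :=
      exists_krausJamiolkowski_eq (posSemidef_partialTransposeA_krausJamiolkowski E)
    refine ⟨E', ?_, ?_⟩
    · rw [Set.mem_ofPred_eq, ← isJamiolkowski_krausJamiolkowski, hE',
        isJamiolkowski_krausJamiolkowski]
      exact hE
    · have h := sum_norm_sq_trace_mul ρ E'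
      rw [hE', ← sum_norm_sq_trace_mul] at h
      exact congrArg Real.sqrt (Complex.ofReal_injective h)
  · rintro _ ⟨E, hE, rfl⟩
    exact mem_krausValues_of_isAdmissibleKraus hE

lemma IsAdmissibleKraus.sum_norm_sq {E : κ → Matrix A A ℂ} (hE : IsAdmissibleKraus ρ σ E) :
    ∑ k, ∑ a, ∑ b, ‖E k b a‖ ^ 2 = Fintype.card A := by
  have h := congrArg Matrix.trace hE.1
  rw [Matrix.trace_sum, Matrix.trace_one] at h
  simp only [trace_conjTranspose_mul_self_eq_sum] at h
  exact_mod_cast h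

lemma isCompact_isAdmissibleKraus :
    IsCompact {E : κ → Matrix A A ℂ | IsAdmissibleKraus ρ σ E} := by
  have hc : IsCompact (Set.univ.pi fun _ : κ => (Set.univ.pi fun _ : A => Set.univ.pi fun _ : A =>
      Metric.closedBall (0 : ℂ) (Fintype.card A + 1) : Set (Matrix A A ℂ))) :=
    isCompact_univ_pi fun _ => isCompact_univ_pi fun _ => isCompact_univ_pi fun _ =>
      isCompact_closedBall _ _
  refine hc.of_isClosed_subset ?_ ?_
  · refine IsClosed.inter (isClosed_eq ?_ continuous_const) (isClosed_eq ?_ continuous_const)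
    · fun_prop
    · fun_prop
  · intro E hE k _ b _ a _
    rw [mem_closedBall_zero_iff]
    have h1 : ‖E k b a‖ ^ 2 ≤ Fintype.card A := by
      rw [← hE.sum_norm_sq]
      calc ‖E k b a‖ ^ 2 ≤ ∑ b, ‖E k b a‖ ^ 2 :=
            Finset.single_le_sum (f := fun b => ‖E k b a‖ ^ 2) (fun _ _ => by positivity)
              (Finset.mem_univ b)
        _ ≤ ∑ a, ∑ b, ‖E k b a‖ ^ 2 :=
            Finset.single_le_sum (f := fun a => ∑ b, ‖E k b a‖ ^ 2) (fun _ _ => by positivity)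
              (Finset.mem_univ a)
        _ ≤ ∑ k, ∑ a, ∑ b, ‖E k b a‖ ^ 2 :=
            Finset.single_le_sum (f := fun k => ∑ a, ∑ b, ‖E k b a‖ ^ 2)
              (fun _ _ => by positivity) (Finset.mem_univ k)
    nlinarith [norm_nonneg (E k b a)]

lemma exists_isAdmissibleKraus (hρ : IsState ρ) (hσ : IsState σ) :
    ∃ E : A × A → Matrix A A ℂ, IsAdmissibleKraus ρ σ E := by
  have hP : (partialTransposeA ((1 : Matrix A A ℂ) ⊗ₖ σ)).PosSemidef := by
    have h : partialTransposeA ((1 : Matrix A A ℂ) ⊗ₖ σ) = (1 : Matrix A A ℂ) ⊗ₖ σ := by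
      ext p q
      simp [partialTransposeA, Matrix.one_apply, eq_comm]
    rw [h]
    exact Matrix.PosSemidef.one.kronecker hσ.1
  obtain ⟨E, hE⟩ := exists_krausJamiolkowski_eq hP
  refine ⟨E, ?_⟩
  rw [← isJamiolkowski_krausJamiolkowski, hE]
  refine ⟨⟨hP, ?_⟩, ?_⟩
  · ext a a'
    have := hσ.2
    rw [Matrix.trace] at this
    simp only [Matrix.diag] at this
    change ∑ b, (1 : Matrix A A ℂ) a a' * σ b b = (1 : Matrix A A ℂ) a a'
    rw [← Finset.mul_sum, this, mul_one]
  · ext b b'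
    have := hρ.2
    rw [Matrix.trace] at this
    simp only [Matrix.diag] at this
    rw [← Matrix.mul_kronecker_mul]
    simp [partialTraceA, ← Finset.sum_mul, this]

lemma exists_isGreatest_krausValues (hρ : IsState ρ) (hσ : IsState σ) :
    ∃ M, IsGreatest (krausValues ρ σ) M := by
  rw [krausValues_eq_image]
  refine (isCompact_isAdmissibleKraus.image ?_).exists_isGreatest
    (Set.Nonempty.image _ (exists_isAdmissibleKraus hρ hσ))
  simp only [Matrix.trace, Matrix.diag, Matrix.mul_apply]
  fun_prop

lemma isLeast_transportCost {d : ℕ} {ρ σ : Matrix (Fin d) (Fin d) ℂ} (hρ : IsState ρ)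
    (hσ : IsState σ) :
    IsLeast (costValues (costMatrix d) ρ σ) (transportCost (costMatrix d) ρ σ) := by
  rw [transportCost, costValues_eq_image hρ.1.1 hσ.2]
  refine (isCompact_isAdmissibleKraus.image ?_).isLeast_sInf
    (Set.Nonempty.image _ (exists_isAdmissibleKraus hρ hσ))
  simp only [Matrix.trace, Matrix.diag, Matrix.mul_apply]
  fun_prop

/-- A trace non-increasing family that preserves the trace of `ρ` extends to a channel by one
Kraus operator that vanishes on `ρ`. -/
lemma exists_mem_krausValues_of_subnormalized (hρ : IsState ρ) (hσ : IsState σ)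
    {F : κ → Matrix A A ℂ} (hF : (1 - ∑ k, (F k)ᴴ * F k).PosSemidef)
    (hFσ : ∑ k, F k * ρ * (F k)ᴴ = σ) :
    √(∑ k, ‖(ρ * F k).trace‖ ^ 2) ∈ krausValues ρ σ := by
  obtain ⟨B, hB⟩ := exists_conjTranspose_mul_self_eq hF
  obtain ⟨R, hR⟩ := exists_conjTranspose_mul_self_eq hρ.1
  have h0 : B * ρ = 0 := by
    have h1 : ((B * Rᴴ)ᴴ * (B * Rᴴ)).trace = 0 := by
      have h2 : (B * Rᴴ)ᴴ * (B * Rᴴ) = R * (Bᴴ * B) * Rᴴ := by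
        simp [Matrix.mul_assoc]
      rw [h2, hB, Matrix.trace_mul_cycle, hR, Matrix.mul_sub, Matrix.mul_one, Matrix.trace_sub,
        hρ.2, Finset.mul_sum, Matrix.trace_sum, ← hσ.2, ← hFσ, Matrix.trace_sum, sub_eq_zero]
      refine Finset.sum_congr rfl fun k _ => ?_
      rw [Matrix.trace_mul_cycle, ← Matrix.mul_assoc, Matrix.trace_mul_comm, ← Matrix.mul_assoc,
        Matrix.trace_mul_comm]
    rw [← hR, ← Matrix.mul_assoc, Matrix.trace_conjTranspose_mul_self_eq_zero_iff.1 h1,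
      Matrix.zero_mul]
  have hE : IsAdmissibleKraus ρ σ (fun o : Option κ => o.elim B F) := by
    constructor
    · simp [Fintype.sum_option, hB]
    · simp [Fintype.sum_option, h0, hFσ]
  have := mem_krausValues_of_isAdmissibleKraus hE
  rw [Fintype.sum_option] at this
  simpa [Matrix.trace_mul_comm ρ B, h0] using this

lemma IsAdmissibleKraus.re_sum_trace_mul_le {E : κ → Matrix A A ℂ}
    (hE : IsAdmissibleKraus ρ σ E) :
    (∑ k, (E k).trace * star (ρ * E k).trace).re ≤
      Fintype.card A * √(∑ k, ‖(ρ * E k).trace‖ ^ 2) := by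
  have h1 : ∑ k, ‖(E k).trace‖ ^ 2 ≤ (Fintype.card A : ℝ) ^ 2 := by
    calc ∑ k, ‖(E k).trace‖ ^ 2 ≤ ∑ k, Fintype.card A * ∑ a, ∑ b, ‖E k b a‖ ^ 2 :=
          Finset.sum_le_sum fun k _ => norm_trace_sq_le _
      _ = (Fintype.card A : ℝ) ^ 2 := by rw [← Finset.mul_sum, hE.sum_norm_sq, sq]
  calc (∑ k, (E k).trace * star (ρ * E k).trace).re
      ≤ ‖∑ k, (E k).trace * star (ρ * E k).trace‖ := Complex.re_le_norm _
    _ ≤ ∑ k, ‖(E k).trace‖ * ‖(ρ * E k).trace‖ := by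
        refine (norm_sum_le _ _).trans_eq ?_
        simp only [norm_mul, norm_star]
    _ ≤ √(∑ k, ‖(E k).trace‖ ^ 2) * √(∑ k, ‖(ρ * E k).trace‖ ^ 2) :=
        Real.sum_mul_le_sqrt_mul_sqrt _ _ _
    _ ≤ Fintype.card A * √(∑ k, ‖(ρ * E k).trace‖ ^ 2) := by
        gcongr
        exact Real.sqrt_le_iff.2 ⟨by positivity, h1⟩

end Admissible

section Embedding

variable {S D κ : Type*} [Fintype S] [Fintype D] {ρ σ : Matrix S S ℂ} {V : Matrix D S ℂ}

lemma trace_embed_mul (X : Matrix S S ℂ) (E : Matrix D D ℂ) :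
    (embed V X * E).trace = (X * (Vᴴ * E * V)).trace := by
  rw [embed, Matrix.trace_mul_comm, ← Matrix.mul_assoc, ← Matrix.mul_assoc, Matrix.trace_mul_comm,
    ← Matrix.mul_assoc, ← Matrix.mul_assoc, Matrix.trace_mul_comm, Matrix.mul_assoc Vᴴ]

variable [DecidableEq S]

lemma mul_conjTranspose_mul_of_isometry {C : Type*} (hV : Vᴴ * V = 1) (X : Matrix S C ℂ) :
    Vᴴ * (V * X) = X := by
  rw [← Matrix.mul_assoc, hV, Matrix.one_mul]

lemma trace_embed (hV : Vᴴ * V = 1) (X : Matrix S S ℂ) : (embed V X).trace = X.trace := by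
  rw [embed, Matrix.trace_mul_comm, mul_conjTranspose_mul_of_isometry hV]

lemma isState_embed (hρ : IsState ρ) (hV : Vᴴ * V = 1) : IsState (embed V ρ) :=
  ⟨hρ.1.mul_mul_conjTranspose_same V, by rw [trace_embed hV, hρ.2]⟩

variable [DecidableEq D]

lemma IsAdmissibleKraus.sqrt_compression_mem_krausValues [Fintype κ] (hρ : IsState ρ)
    (hσ : IsState σ)
    (hV : Vᴴ * V = 1) {E : κ → Matrix D D ℂ}
    (hE : IsAdmissibleKraus (embed V ρ) (embed V σ) E) :
    √(∑ k, ‖(embed V ρ * E k).trace‖ ^ 2) ∈ krausValues ρ σ := by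
  simp only [trace_embed_mul]
  refine exists_mem_krausValues_of_subnormalized hρ hσ ?_ ?_
  · have hQ : ((1 - V * Vᴴ)ᴴ * (1 - V * Vᴴ)) = 1 - V * Vᴴ := by
      simp [Matrix.mul_sub, Matrix.sub_mul, Matrix.mul_assoc, mul_conjTranspose_mul_of_isometry hV]
    have h : 1 - ∑ k, (Vᴴ * E k * V)ᴴ * (Vᴴ * E k * V) =
        ∑ k, ((1 - V * Vᴴ) * E k * V)ᴴ * ((1 - V * Vᴴ) * E k * V) := by
      have h1 : ∑ k, Vᴴ * ((E k)ᴴ * E k) * V = 1 := by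
        rw [← Matrix.sum_mul, ← Matrix.mul_sum, hE.1, Matrix.mul_one, hV]
      rw [← h1, ← Finset.sum_sub_distrib]
      refine Finset.sum_congr rfl fun k _ => ?_
      have h2 : ((1 - V * Vᴴ) * E k * V)ᴴ * ((1 - V * Vᴴ) * E k * V) =
          Vᴴ * (E k)ᴴ * ((1 - V * Vᴴ)ᴴ * (1 - V * Vᴴ)) * E k * V := by
        simp only [Matrix.conjTranspose_mul, Matrix.mul_assoc]
      rw [h2, hQ]
      simp [Matrix.mul_sub, Matrix.sub_mul, Matrix.mul_assoc]
    rw [h]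
    exact Matrix.posSemidef_sum _ fun k _ => Matrix.posSemidef_conjTranspose_mul_self _
  · have h := congrArg (fun X => Vᴴ * X * V) hE.2
    simp only [embed, Matrix.mul_sum, Matrix.sum_mul, Matrix.mul_assoc, hV,
      mul_conjTranspose_mul_of_isometry hV, Matrix.mul_one] at h
    rw [← h]
    refine Finset.sum_congr rfl fun k _ => ?_
    simp [Matrix.mul_assoc]

/-- Kraus operators that act as `A k` on `H_S` and as the scalar `δ k` on its complement. -/
def extendKraus (V : Matrix D S ℂ) (A : κ → Matrix S S ℂ) (δ : κ → ℂ) (k : κ) : Matrix D D ℂ :=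
  embed V (A k) + δ k • (1 - V * Vᴴ)

lemma trace_extendKraus (hV : Vᴴ * V = 1) (A : κ → Matrix S S ℂ) (δ : κ → ℂ) (k : κ) :
    (extendKraus V A δ k).trace =
      (A k).trace + δ k * ((Fintype.card D : ℂ) - Fintype.card S) := by
  have h : (V * Vᴴ).trace = Fintype.card S := by
    rw [Matrix.trace_mul_comm, hV, Matrix.trace_one]
  rw [extendKraus, Matrix.trace_add, trace_embed hV, Matrix.trace_smul, Matrix.trace_sub, h,
    Matrix.trace_one, smul_eq_mul]

lemma trace_embed_mul_extendKraus (hV : Vᴴ * V = 1) (A : κ → Matrix S S ℂ) (δ : κ → ℂ) (k : κ) :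
    (embed V ρ * extendKraus V A δ k).trace = (ρ * A k).trace := by
  rw [trace_embed_mul, extendKraus, embed]
  simp [Matrix.mul_add, Matrix.mul_sub, Matrix.mul_assoc, mul_conjTranspose_mul_of_isometry hV, hV]

variable [Fintype κ]

lemma isAdmissibleKraus_extendKraus (hV : Vᴴ * V = 1) {A : κ → Matrix S S ℂ}
    (hA : IsAdmissibleKraus ρ σ A) {δ : κ → ℂ} (hδ : ∑ k, star (δ k) * δ k = 1) :
    IsAdmissibleKraus (embed V ρ) (embed V σ)
      (extendKraus V A δ) := by
  constructor
  · have h : ∀ k, (extendKraus V A δ k)ᴴ * extendKraus V A δ k =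
        V * ((A k)ᴴ * A k) * Vᴴ + (star (δ k) * δ k) • (1 - V * Vᴴ) := by
      intro k
      simp [extendKraus, embed, Matrix.mul_add, Matrix.add_mul, Matrix.mul_sub,
        Matrix.sub_mul, Matrix.mul_assoc, mul_conjTranspose_mul_of_isometry hV, smul_smul, mul_comm]
    simp only [h]
    rw [Finset.sum_add_distrib, ← Matrix.sum_mul, ← Matrix.mul_sum, ← Finset.sum_smul, hA.1, hδ]
    simp
  · have h : ∀ k, extendKraus V A δ k * embed V ρ *
        (extendKraus V A δ k)ᴴ = V * (A k * ρ * (A k)ᴴ) * Vᴴ := by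
      intro k
      simp [extendKraus, embed, Matrix.mul_add, Matrix.add_mul, Matrix.mul_sub,
        Matrix.sub_mul, Matrix.mul_assoc, mul_conjTranspose_mul_of_isometry hV]
    simp only [h]
    rw [← Matrix.sum_mul, ← Matrix.mul_sum, hA.2, embed]

end Embedding

lemma exists_unit_vector_sum_mul_star_eq {κ : Type*} [Fintype κ] [Nonempty κ] (c : κ → ℂ) :
    ∃ δ : κ → ℂ, ∑ k, star (δ k) * δ k = 1 ∧
      ∑ k, δ k * star (c k) = ((√(∑ k, ‖c k‖ ^ 2) : ℝ) : ℂ) := by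
  classical
  set M := √(∑ k, ‖c k‖ ^ 2) with hM
  have hsq : M * M = ∑ k, ‖c k‖ ^ 2 := Real.mul_self_sqrt (by positivity)
  by_cases h0 : M = 0
  · have hc : ∀ k, c k = 0 := by
      rw [h0, mul_zero, eq_comm, Finset.sum_eq_zero_iff_of_nonneg fun _ _ => by positivity] at hsq
      intro k
      simpa using hsq k (Finset.mem_univ k)
    obtain ⟨k₀⟩ := ‹Nonempty κ›
    refine ⟨Pi.single k₀ 1, ?_, ?_⟩
    · rw [Finset.sum_eq_single k₀ (fun k _ hk => by simp [hk]) (by simp)]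
      simp
    · simp [hc, h0]
  · have h0' : (M : ℂ) ≠ 0 := by exact_mod_cast h0
    have hsq' : ∑ k, c k * star (c k) = (M : ℂ) * M := by
      rw [← Complex.ofReal_mul, hsq]
      push_cast
      exact Finset.sum_congr rfl fun k _ => Complex.mul_conj' _
    refine ⟨fun k => c k / M, ?_, ?_⟩
    · have h : ∀ k, star (c k / (M : ℂ)) * (c k / M) = c k * star (c k) / (M * M) := by
        intro k
        simp only [Complex.star_def, map_div₀, Complex.conj_ofReal]
        ring
      simp only [h]
      rw [← Finset.sum_div, hsq', div_self (mul_ne_zero h0' h0')]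
    · simp only [div_mul_eq_mul_div]
      rw [← Finset.sum_div, hsq', mul_div_assoc, div_self h0', mul_one]

end QuantumTransport

end

open QuantumTransport
theorem mainTheorem3 {S : Type*} [Fintype S] [DecidableEq S] (ρ σ : Matrix S S ℂ)
    (hρ : IsState ρ) (hσ : IsState σ) (hsupp : jointSupport ρ σ = ⊤) :
    ∃ M : ℝ, IsGreatest (krausValues ρ σ) M ∧
      ∀ V : (d : ℕ) → Matrix (Fin d) S ℂ,
        (∀ d, Fintype.card S ≤ d → (V d)ᴴ * V d = 1) →
        (∀ d, Fintype.card S ≤ d →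
          IsLeast (costValues (costMatrix d) (embed (V d) ρ) (embed (V d) σ))
            (transportCost (costMatrix d) (embed (V d) ρ) (embed (V d) σ))) ∧
        Filter.Tendsto
          (fun d : ℕ => transportCost (costMatrix d) (embed (V d) ρ) (embed (V d) σ))
          Filter.atTop (nhds (1 - M)) := by
  obtain ⟨M, hM⟩ := exists_isGreatest_krausValues hρ hσ
  refine ⟨M, hM, fun V hV => ?_⟩
  have hleast : ∀ d, Fintype.card S ≤ d →
      IsLeast (costValues (costMatrix d) (embed (V d) ρ) (embed (V d) σ))
        (transportCost (costMatrix d) (embed (V d) ρ) (embed (V d) σ)) := fun d hd =>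
    isLeast_transportCost (isState_embed hρ (hV d hd)) (isState_embed hσ (hV d hd))
  refine ⟨hleast, ?_⟩
  have hS : Nonempty S := by
    by_contra h
    rw [not_nonempty_iff] at h
    simpa [Matrix.trace] using hρ.2
  obtain ⟨A, hA, hAM⟩ := krausValues_eq_image.subset hM.1
  obtain ⟨δ, hδ, hδM⟩ := exists_unit_vector_sum_mul_star_eq fun k => (ρ * A k).trace
  dsimp only at hAM
  rw [hAM] at hδM
  set T : ℝ := (∑ k, (A k).trace * star (ρ * A k).trace).re
  have hlim : Filter.Tendsto (fun d : ℕ => 1 - (M + (T - Fintype.card S * M) / d))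
      Filter.atTop (nhds (1 - M)) := by
    have h := (tendsto_const_div_atTop_nhds_zero_nat (T - Fintype.card S * M)).const_add M
    rw [add_zero] at h
    exact h.const_sub 1
  refine tendsto_of_tendsto_of_tendsto_of_le_of_le' tendsto_const_nhds hlim ?_ ?_
  · filter_upwards [Filter.eventually_ge_atTop (Fintype.card S)] with d hd
    have hd0 : (0 : ℝ) < d := by exact_mod_cast Fintype.card_pos.trans_le hd
    have hmem := (hleast d hd).1
    rw [costValues_eq_image (isState_embed hρ (hV d hd)).1.1 (isState_embed hσ (hV d hd)).2] at hmem
    obtain ⟨E, hE, hEc⟩ := hmem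
    rw [← hEc]
    have h1 := hE.re_sum_trace_mul_le
    have h2 := hM.2 (hE.sqrt_compression_mem_krausValues hρ hσ (hV d hd))
    rw [Fintype.card_fin] at h1
    dsimp only
    rw [sub_le_sub_iff_left, one_div, inv_mul_le_iff₀ hd0]
    exact h1.trans (by gcongr)
  · filter_upwards [Filter.eventually_ge_atTop (Fintype.card S)] with d hd
    have hd0 : (0 : ℝ) < d := by exact_mod_cast Fintype.card_pos.trans_le hd
    refine ((hleast d hd).2 (mem_costValues_of_isAdmissibleKraus (isState_embed hρ (hV d hd)).1.1
      (isState_embed hσ (hV d hd)).2 (isAdmissibleKraus_extendKraus (hV d hd) hA hδ))).trans_eq ?_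
    simp only [trace_extendKraus (hV d hd), trace_embed_mul_extendKraus (hV d hd)]
    have h : ∑ k, ((A k).trace + δ k * ((Fintype.card (Fin d) : ℂ) - Fintype.card S)) *
        star (ρ * A k).trace = ∑ k, (A k).trace * star (ρ * A k).trace +
          ((((d : ℝ) - Fintype.card S) * M : ℝ) : ℂ) := by
      simp only [add_mul, Finset.sum_add_distrib]
      push_cast
      rw [← hδM, Finset.mul_sum, Fintype.card_fin]
      congr 1
      exact Finset.sum_congr rfl fun k _ => by ring
    rw [h, Complex.add_re, Complex.ofReal_re]
    field_simp
    ring
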